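/- \textbf{Proposition (Sampling Error of EDMD).} Let $\mu$ be a probability measure on a measurable space $\mathcal S$ and let $f:\mathcal S\to\mathcal S$ be measurable and $\mu$-preserving. Let $\boldsymbol\Phi=(\phi_1,\dots,\phi_n)^\top:\mathcal S\to\mathbb R^n$ be measurable with $\|\boldsymbol\Phi(s)\|_2\le B$ for all $s\in\mathcal S$, where $B>0$. Let $s_1,\dots,s_m$ ($m\ge 1$) be i.i.d. with law $\mu$, and put $s_i^+=f(s_i)$. Define $$\mathbf G_n=\mathbb E_{s\sim\mu}[\boldsymbol\Phi(s)\boldsymbol\Phi(s)^\top],\quad \mathbf A_n=\mathbb E_{s\sim\mu}[\boldsymbol\Phi(f(s))\boldsymbol\Phi(s)^\top],\quad \mathbf G_{n,m}=\frac1m\sum_{i=1}^m\boldsymbol\Phi(s_i)\boldsymbol\Phi(s_i)^\top,\quad \mathbf A_{n,m}=\frac1m\sum_{i=1}^m\boldsymbol\Phi(s_i^+)\boldsymbol\Phi(s_i)^\top .$$ Assume that $\lambda_{\min}(\mathbf G_n)\ge\gamma>0$ and that $\lambda_{\min}(\mathbf G_{n,m})\ge\gamma/2$ with probability at least $1-\delta_m$.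 Let $\mathcal H=L^2(\mathcal S,\mu)$ (with real or complex scalars), let $\mathcal H_n=\operatorname{span}\{\phi_1,\dots,\phi_n\}\subset\mathcal H$, and let $\mathcal P_n:\mathcal H\to\mathcal H_n$ be the orthogonal projection. Since $\mathbf G_n$ is positive definite, $\phi_1,\dots,\phi_n$ are linearly independent in $\mathcal H$, so an $n\times n$ real matrix $\mathbf K$ acts on $\mathcal H_n$ by $\mathbf c^\top\boldsymbol\Phi\mapsto\mathbf c^\top\mathbf K\boldsymbol\Phi$. Let $\mathcal K_n$ and $\mathcal K_{n,m}$ be the operators on $\mathcal H_n$ given in this way by $\mathbf K_n=\mathbf A_n\mathbf G_n^{-1}$ and, when $\mathbf G_{n,m}$ is invertible, by the EDMD matrix $\mathbf K_{n,m}=\mathbf A_{n,m}\mathbf G_{n,m}^{-1}$. Then, for every $\delta>0$, with probability at least $1-2\delta-\delta_m$ the matrix $\mathbf G_{n,m}$ is invertible and $$\|(\mathcal K_{n,m}-\mathcal K_n)\mathcal P_n\|_{\mathcal L(\mathcal H)}\le\kappa_{\mathrm{bias}}\,\frac{\ln(2n/\delta)}{m}+\kappa_{\mathrm{var}}\sqrt{\frac{\ln(2n/\delta)}{m}},$$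 where $$\kappa_{\mathrm{bias}}=\frac{4B^3}{3\sqrt{\gamma^3}}\Big(\frac{2B^2}{\gamma}+1\Big),\qquad \kappa_{\mathrm{var}}=\frac{2\sqrt2\,B^3}{\sqrt{\gamma^3}}\Big(\frac{2B^2}{\gamma}+1\Big).$$ (If $\ln(2n/\delta)<0$ then $1-2\delta-\delta_m<0$ and the assertion is empty.) -/

import Mathlib

open MeasureTheory ProbabilityTheory

namespace EDMD

noncomputable section

variable {S : Type*} {n m : ℕ}

/-- The smallest eigenvalue of a real symmetric matrix of positive size. -/
def lambdaMin (M : Matrix (Fin n) (Fin n) ℝ) : ℝ := sInf (spectrum ℝ M)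

/-- Empirical Gram matrix `(1/m) ∑ₖ Φ(xₖ) Φ(xₖ)ᵀ` of the sample points `x₁, …, xₘ`. -/
def empGram (Φ : S → EuclideanSpace ℝ (Fin n)) (x : Fin m → S) : Matrix (Fin n) (Fin n) ℝ :=
  (1 / (m : ℝ)) • ∑ k, Matrix.vecMulVec (Φ (x k)).ofLp (Φ (x k)).ofLp

/-- Empirical correlation matrix `(1/m) ∑ₖ Φ(xₖ⁺) Φ(xₖ)ᵀ`, where `xₖ⁺ = f(xₖ)`. -/
def empCorr (f : S → S) (Φ : S → EuclideanSpace ℝ (Fin n)) (x : Fin m → S) :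
    Matrix (Fin n) (Fin n) ℝ :=
  (1 / (m : ℝ)) • ∑ k, Matrix.vecMulVec (Φ (f (x k))).ofLp (Φ (x k)).ofLp

/-- The EDMD matrix `K_{n,m} = A_{n,m} G_{n,m}⁻¹`. -/
def empMatrix (f : S → S) (Φ : S → EuclideanSpace ℝ (Fin n)) (x : Fin m → S) :
    Matrix (Fin n) (Fin n) ℝ :=
  empCorr f Φ x * (empGram Φ x)⁻¹

variable [MeasurableSpace S]

/-- Population Gram matrix `G_n = E[Φ(s) Φ(s)ᵀ]`, `s ∼ μ`. -/
def popGram (μ : Measure S) (Φ : S → EuclideanSpace ℝ (Fin n)) : Matrix (Fin n) (Fin n) ℝ :=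
  Matrix.of fun i j => ∫ s, Φ s i * Φ s j ∂μ

/-- Population correlation matrix `A_n = E[Φ(s⁺) Φ(s)ᵀ]`, `s ∼ μ`, `s⁺ = f(s)`. -/
def popCorr (μ : Measure S) (f : S → S) (Φ : S → EuclideanSpace ℝ (Fin n)) :
    Matrix (Fin n) (Fin n) ℝ :=
  Matrix.of fun i j => ∫ s, Φ (f s) i * Φ s j ∂μ

/-- The population EDMD matrix `K_n = A_n G_n⁻¹`. -/
def popMatrix (μ : Measure S) (f : S → S) (Φ : S → EuclideanSpace ℝ (Fin n)) :
    Matrix (Fin n) (Fin n) ℝ :=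
  popCorr μ f Φ * (popGram μ Φ)⁻¹

variable (𝕜 : Type*) [RCLike 𝕜] (μ : Measure S) [IsFiniteMeasure μ]
  {Φ : S → EuclideanSpace ℝ (Fin n)} {B : ℝ}

theorem memLp_feature (hΦ : Measurable Φ) (hB : ∀ s, ‖Φ s‖ ≤ B) (i : Fin n) :
    MemLp (fun s => ((Φ s i : ℝ) : 𝕜)) 2 μ := by
  have hm : Measurable fun s => ((Φ s i : ℝ) : 𝕜) := by fun_prop
  refine MemLp.of_bound hm.aestronglyMeasurable B (Filter.Eventually.of_forall fun s => ?_)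
  rw [RCLike.norm_ofReal, ← Real.norm_eq_abs]
  exact (PiLp.norm_apply_le (Φ s) i).trans (hB s)

/-- The observable `φᵢ` (the `i`-th coordinate of `Φ`) as an element of `L²(μ)`. -/
def feature (hΦ : Measurable Φ) (hB : ∀ s, ‖Φ s‖ ≤ B) (i : Fin n) : Lp 𝕜 2 μ :=
  (memLp_feature 𝕜 μ hΦ hB i).toLp

variable {𝕜} {E : Type*} [NormedAddCommGroup E] [InnerProductSpace 𝕜 E]

/-- The subspace `H_n = span {φ₁, …, φₙ}`. -/
abbrev latentSpace (𝕜 : Type*) [RCLike 𝕜] {E : Type*} [NormedAddCommGroup E]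
    [InnerProductSpace 𝕜 E] (φ : Fin n → E) : Submodule 𝕜 E :=
  Submodule.span 𝕜 (Set.range φ)

instance finiteDimensional_latentSpace (φ : Fin n → E) :
    FiniteDimensional 𝕜 (latentSpace 𝕜 φ) :=
  FiniteDimensional.span_of_finite 𝕜 (Set.finite_range φ)

/-- The observable `φᵢ` as an element of `H_n`. -/
def gen (𝕜 : Type*) [RCLike 𝕜] {E : Type*} [NormedAddCommGroup E]
    [InnerProductSpace 𝕜 E] (φ : Fin n → E) (i : Fin n) : latentSpace 𝕜 φ :=
  ⟨φ i, Submodule.subset_span ⟨i, rfl⟩⟩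

/-- The operator on `H_n = span {φ₁, …, φₙ}` realised by the real matrix `M`, i.e.
`cᵀ Φ ↦ cᵀ M Φ`; equivalently `φᵢ ↦ ∑ⱼ Mᵢⱼ φⱼ`. It is only meaningful (and is set to `0`
otherwise) when the `φᵢ` are linearly independent, so that coefficient vectors are unique. -/
def matrixOperator (φ : Fin n → E) (M : Matrix (Fin n) (Fin n) ℝ) :
    latentSpace 𝕜 φ →L[𝕜] latentSpace 𝕜 φ :=
  open Classical in
  if h : LinearIndependent 𝕜 φ then
    LinearMap.toContinuousLinearMap
      ((Module.Basis.span h).constr 𝕜 fun i =>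
        ∑ j, ((M i j : ℝ) : 𝕜) • gen 𝕜 φ j)
  else 0

theorem matrixOperator_gen (φ : Fin n → E) (h : LinearIndependent 𝕜 φ)
    (M : Matrix (Fin n) (Fin n) ℝ) (i : Fin n) :
    matrixOperator φ M (gen 𝕜 φ i) = ∑ j, ((M i j : ℝ) : 𝕜) • gen 𝕜 φ j := by
  have hb : gen 𝕜 φ i = Module.Basis.span h i := by
    ext; simp [gen, Module.Basis.span_apply]
  rw [matrixOperator, dif_pos h, hb, LinearMap.coe_toContinuousLinearMap',
    Module.Basis.constr_basis]

/-- The norm on `E` of `(T_M - T_N) P_n`, where `P_n` is the orthogonal projection of `E` onto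
`H_n = span {φ₁, …, φₙ}` and `T_M`, `T_N` are the operators on `H_n` realised by `M`, `N`. -/
def operatorDeviation (φ : Fin n → E) (M N : Matrix (Fin n) (Fin n) ℝ) : ℝ :=
  ‖(latentSpace 𝕜 φ).subtypeL ∘L
    (matrixOperator (𝕜 := 𝕜) φ M - matrixOperator (𝕜 := 𝕜) φ N) ∘L
    (latentSpace 𝕜 φ).orthogonalProjectionOnto‖

variable (𝕜)

theorem inner_feature (hΦ : Measurable Φ) (hB : ∀ s, ‖Φ s‖ ≤ B) (i j : Fin n) :
    inner 𝕜 (feature 𝕜 μ hΦ hB i) (feature 𝕜 μ hΦ hB j) = ((popGram μ Φ i j : ℝ) : 𝕜) := by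
  rw [L2.inner_def, popGram, Matrix.of_apply, ← integral_ofReal]
  refine integral_congr_ae ?_
  filter_upwards [(memLp_feature 𝕜 μ hΦ hB i).coeFn_toLp,
    (memLp_feature 𝕜 μ hΦ hB j).coeFn_toLp] with x hi hj
  simp only [feature, hi, hj, RCLike.inner_apply, RCLike.conj_ofReal, RCLike.ofReal_mul]
  ring

/-- The observables are linearly independent as soon as `G_n` is positive definite. -/
theorem linearIndependent_feature (hΦ : Measurable Φ) (hB : ∀ s, ‖Φ s‖ ≤ B)
    (hpos : 0 < lambdaMin (popGram μ Φ)) :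
    LinearIndependent 𝕜 (feature 𝕜 μ hΦ hB) := by
  have hunit : IsUnit (popGram μ Φ) := by
    by_contra hcon
    have h0 : (0 : ℝ) ∈ spectrum ℝ (popGram μ Φ) := by
      rwa [spectrum.zero_mem_iff]
    have := csInf_le (Matrix.finite_real_spectrum (A := popGram μ Φ)).bddBelow h0
    exact absurd hpos (not_lt.2 this)
  rw [Fintype.linearIndependent_iff]
  intro c hc
  have key : ((popGram μ Φ).map (algebraMap ℝ 𝕜)).mulVec c = 0 := by
    ext i
    have := congrArg (inner 𝕜 (feature 𝕜 μ hΦ hB i)) hc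
    simp only [inner_sum, inner_smul_right, inner_feature, inner_zero_right] at this
    simp only [Matrix.mulVec, dotProduct, Matrix.map_apply, Pi.zero_apply]
    rw [← this]
    exact Finset.sum_congr rfl fun j _ => mul_comm _ _
  have hu : IsUnit ((popGram μ Φ).map (algebraMap ℝ 𝕜)) :=
    hunit.map (algebraMap ℝ 𝕜).mapMatrix
  have := (Matrix.mulVec_injective_iff_isUnit.2 hu) (key.trans (Matrix.mulVec_zero _).symm)
  exact fun i => congrFun this i

/-- The sampling error `‖(𝒦_{n,m} - 𝒦_n) P_n‖` in the operator norm of `L²(μ)`, for the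
sample `(x₁, f(x₁)), …, (xₘ, f(xₘ))`. -/
def samplingError (f : S → S) (hΦ : Measurable Φ) (hB : ∀ s, ‖Φ s‖ ≤ B) (x : Fin m → S) : ℝ :=
  operatorDeviation (𝕜 := 𝕜) (feature 𝕜 μ hΦ hB) (empMatrix f Φ x) (popMatrix μ f Φ)

end

end EDMD

/-! The estimate splits into a deterministic perturbation bound and a concentration bound.
Deterministically, `‖cᵀΦ‖²` in `L²(μ)` is the quadratic form of `G_n`, which lies between `γ‖c‖²`
and `B²‖c‖²`; so passing from operators on `H_n` to matrices costs a factor `B/√γ`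
(`operatorDeviation_le`). The matrices are compared by `A'G'⁻¹ - AG⁻¹ = (A' - A)G⁻¹ - A'G'⁻¹(G' -
G)G⁻¹`, with `‖A'‖ ≤ B²`, `‖G⁻¹‖ ≤ 1/γ` and `‖G'⁻¹‖ ≤ 2/γ` (`norm_mul_inv_sub_mul_inv_le`).

For the concentration, outer products are regarded as vectors in the Hilbert space of `n × n`
matrices with the Frobenius norm, which dominates the operator norm. Pinelis' inequality
(`measureReal_norm_sum_gt_le`) then bounds each of the two matrix errors by `2√2 B² √(ln(2/δ)/m)`
outside an event of probability `δ`. A union bound with the event on `λ_min(G_{n,m})` finishes. This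
bound is free of dimension, so the variance term alone suffices: the bias term and the `n` in the
logarithm are slack.

The key fact behind Pinelis' inequality is that `u ↦ cosh √u` has a power series with nonnegative
coefficients, hence is increasing and convex on `[0, ∞)`. -/

theorem Real.cosh_le_of_sq_le {r p q α β : ℝ} (hα : 0 ≤ α) (hβ : 0 ≤ β) (hαβ : α + β = 1)
    (h : r ^ 2 ≤ α * p ^ 2 + β * q ^ 2) :
    Real.cosh r ≤ α * Real.cosh p + β * Real.cosh q := by
  refine hasSum_le (fun k => ?_) (Real.hasSum_cosh r)
    (((Real.hasSum_cosh p).mul_left α).add ((Real.hasSum_cosh q).mul_left β))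
  have hconv : (α * p ^ 2 + β * q ^ 2) ^ k ≤ α * (p ^ 2) ^ k + β * (q ^ 2) ^ k :=
    (convexOn_pow k).2 (sq_nonneg p) (sq_nonneg q) hα hβ hαβ
  have hpow := (pow_le_pow_left₀ (sq_nonneg r) h k).trans hconv
  simp only [← pow_mul] at hpow
  calc r ^ (2 * k) / ((2 * k).factorial : ℝ)
      ≤ (α * p ^ (2 * k) + β * q ^ (2 * k)) / ((2 * k).factorial : ℝ) := by gcongr
    _ = _ := by ring

/-! ### Hoeffding's inequality in Hilbert space -/

section Pinelis

variable {E : Type*} [NormedAddCommGroup E] [InnerProductSpace ℝ E]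

/-- With `t = ⟨x, y⟩ / (‖x‖ L)`, the number `‖x + y‖²` is at most the average of `(‖x‖ ± L)²` with
weights `(1 ± t)/2`, so convexity of `cosh √u` applies. The correction term is linear in `y`: it has
mean zero when `y` is centred and independent of `x`. -/
theorem cosh_norm_add_le {L : ℝ} (hL : 0 < L) (x y : E) (hy : ‖y‖ ≤ L) :
    Real.cosh ‖x + y‖ ≤ Real.cosh ‖x‖ * Real.cosh L +
      inner ℝ ((Real.sinh ‖x‖ * Real.sinh L / (‖x‖ * L)) • x) y := by
  have hin : |inner ℝ x y| ≤ ‖x‖ * L :=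
    (abs_real_inner_le_norm x y).trans (by gcongr)
  have hsq : ‖y‖ ^ 2 ≤ L ^ 2 := by gcongr
  rw [real_inner_smul_left]
  rcases (norm_nonneg x).eq_or_lt with h0 | hpos
  · have hx : x = 0 := norm_eq_zero.1 h0.symm
    simp only [hx, zero_add, norm_zero, Real.cosh_zero, one_mul, inner_zero_left, mul_zero,
      add_zero]
    exact Real.cosh_le_cosh.2 (by rwa [abs_norm, abs_of_pos hL])
  · set t : ℝ := inner ℝ x y / (‖x‖ * L) with ht
    have hxL : 0 < ‖x‖ * L := mul_pos hpos hL
    have htabs : |t| ≤ 1 := by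
      rw [ht, abs_div, abs_of_pos hxL]
      exact (div_le_one hxL).2 hin
    have hti : inner ℝ x y = t * (‖x‖ * L) := by rw [ht]; field_simp
    obtain ⟨h1, h2⟩ := abs_le.1 htabs
    have hkey := Real.cosh_le_of_sq_le (r := ‖x + y‖) (p := ‖x‖ + L) (q := ‖x‖ - L)
      (α := (1 + t) / 2) (β := (1 - t) / 2) (by linarith) (by linarith) (by ring)
      (by rw [norm_add_sq_real, hti]; linarith)
    refine hkey.trans (le_of_eq ?_)
    rw [Real.cosh_add, Real.cosh_sub, hti]
    field_simp
    ring

variable [MeasurableSpace E] [BorelSpace E] [SecondCountableTopology E] [CompleteSpace E]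
  {Ω : Type*} [MeasurableSpace Ω] {P : Measure Ω} [IsProbabilityMeasure P]

theorem integrable_comp_of_norm_le {F : Type*} [NormedAddCommGroup F]
    {X : Ω → F} (hX : AEStronglyMeasurable X P) {C : ℝ}
    (hb : ∀ ω, ‖X ω‖ ≤ C) : Integrable X P :=
  Integrable.of_bound hX C (Filter.Eventually.of_forall hb)

theorem integral_cosh_norm_sum_le {ι : Type*} {X : ι → Ω → E} (hmeas : ∀ i, Measurable (X i))
    (hind : iIndepFun X P) {L : ℝ} (hL : 0 < L) (hb : ∀ i ω, ‖X i ω‖ ≤ L)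
    (hmean : ∀ i, ∫ ω, X i ω ∂P = 0) (A : Finset ι) :
    ∫ ω, Real.cosh ‖∑ i ∈ A, X i ω‖ ∂P ≤ Real.cosh L ^ A.card := by
  classical
  induction A using Finset.induction_on with
  | empty => simp
  | insert j A hj ih =>
    set T : Ω → E := fun ω => ∑ i ∈ A, X i ω with hT
    have hTm : Measurable T := by fun_prop
    have hTb : ∀ ω, ‖T ω‖ ≤ A.card * L := fun ω => by
      simpa using norm_sum_le_of_le A fun i _ => hb i ω
    have hTX : IndepFun T (X j) P := by
      have := hind.indepFun_finsetSum_of_notMem hmeas hj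
      convert this using 1
      ext ω; simp [hT]
    set g : E → E := fun x => (Real.sinh ‖x‖ * Real.sinh L / (‖x‖ * L)) • x with hg
    have hgm : Measurable g := by fun_prop
    have hgn : ∀ x, ‖g x‖ ≤ Real.sinh ‖x‖ * Real.sinh L / L := fun x => by
      have hs : 0 ≤ Real.sinh ‖x‖ := Real.sinh_nonneg_iff.2 (norm_nonneg x)
      have hsL : 0 ≤ Real.sinh L := Real.sinh_nonneg_iff.2 hL.le
      rw [hg, norm_smul, Real.norm_of_nonneg (by positivity)]
      rcases (norm_nonneg x).eq_or_lt with h0 | hpos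
      · simp [← h0]
      · apply le_of_eq; field_simp
    have hgT : ∀ ω, ‖g (T ω)‖ ≤ Real.sinh (A.card * L) * Real.sinh L / L := fun ω => by
      have hsL : 0 ≤ Real.sinh L := Real.sinh_nonneg_iff.2 hL.le
      refine (hgn _).trans ?_
      have := Real.sinh_le_sinh.2 (hTb ω)
      gcongr
    have hgi : Integrable (fun ω => g (T ω)) P :=
      integrable_comp_of_norm_le (hgm.comp hTm).aestronglyMeasurable hgT
    have hXi : Integrable (X j) P :=
      integrable_comp_of_norm_le (hmeas j).aestronglyMeasurable (hb j)
    have hgX : IndepFun (fun ω => g (T ω)) (X j) P := hTX.comp hgm measurable_id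
    have hprod : ∫ ω, inner ℝ (g (T ω)) (X j ω) ∂P = 0 := by
      have := hgX.integral_bilin hgi hXi (innerSL ℝ)
      exact this.trans (by rw [hmean j, map_zero])
    have hprodi : Integrable (fun ω => inner ℝ (g (T ω)) (X j ω)) P := by
      refine integrable_comp_of_norm_le (C := Real.sinh (A.card * L) * Real.sinh L / L * L) ?_ ?_
      · exact ((hgm.comp hTm).inner (hmeas j)).aestronglyMeasurable
      · exact fun ω => (norm_inner_le_norm _ _).trans
          (mul_le_mul (hgT ω) (hb j ω) (norm_nonneg _) ((norm_nonneg _).trans (hgT ω)))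
    have hcoshi : ∀ Y : Ω → E, Measurable Y → ∀ C, (∀ ω, ‖Y ω‖ ≤ C) →
        Integrable (fun ω => Real.cosh ‖Y ω‖) P := fun Y hY C hC => by
      refine integrable_comp_of_norm_le (C := Real.cosh C)
        (Real.measurable_cosh.comp hY.norm).aestronglyMeasurable fun ω => ?_
      rw [Real.norm_of_nonneg (Real.cosh_pos _).le]
      exact Real.cosh_le_cosh.2 (by rw [abs_norm]; exact (hC ω).trans (le_abs_self C))
    have hTi := hcoshi T hTm _ hTb
    calc ∫ ω, Real.cosh ‖∑ i ∈ insert j A, X i ω‖ ∂P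
        = ∫ ω, Real.cosh ‖T ω + X j ω‖ ∂P := by
          simp only [Finset.sum_insert hj, hT, add_comm]
      _ ≤ ∫ ω, (Real.cosh ‖T ω‖ * Real.cosh L + inner ℝ (g (T ω)) (X j ω)) ∂P := by
          refine integral_mono (hcoshi _ (hTm.add (hmeas j)) (A.card * L + L) fun ω => ?_)
            ((hTi.mul_const _).add hprodi) fun ω => cosh_norm_add_le hL _ _ (hb j ω)
          exact (norm_add_le _ _).trans (add_le_add (hTb ω) (hb j ω))
      _ = (∫ ω, Real.cosh ‖T ω‖ ∂P) * Real.cosh L := by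
          rw [integral_add (hTi.mul_const _) hprodi, hprod, add_zero, integral_mul_const]
      _ ≤ Real.cosh L ^ A.card * Real.cosh L := by
          have := (Real.cosh_pos L).le
          gcongr
      _ = Real.cosh L ^ (insert j A).card := by
          rw [Finset.card_insert_of_notMem hj, pow_succ]

/-- Pinelis' form of the Hoeffding inequality for Hilbert space valued random variables. -/
theorem measureReal_norm_sum_gt_le {ι : Type*} [Fintype ι] [Nonempty ι] {X : ι → Ω → E}
    (hmeas : ∀ i, Measurable (X i))
    (hind : iIndepFun X P) {L : ℝ} (hL : 0 < L) (hb : ∀ i ω, ‖X i ω‖ ≤ L)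
    (hmean : ∀ i, ∫ ω, X i ω ∂P = 0) {δ : ℝ} (hδ : 0 < δ) (hδ2 : δ < 2) :
    P.real {ω | L * √(2 * Fintype.card ι * Real.log (2 / δ)) < ‖∑ i, X i ω‖} ≤ δ := by
  set N : ℝ := (Fintype.card ι : ℝ) with hN
  have hNpos : 0 < N := by simp [hN, Fintype.card_pos]
  set l := Real.log (2 / δ) with hl
  have hlpos : 0 < l := Real.log_pos ((one_lt_div hδ).2 hδ2)
  set r := √(2 * N * l) with hr
  have hrpos : 0 < r := Real.sqrt_pos.2 (by positivity)
  have hr2 : r ^ 2 = 2 * N * l := Real.sq_sqrt (by positivity)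
  -- This `c` minimises the Chernoff exponent `N(cL)²/2 - cLr`. The first term becomes `l` and the
  -- second `2l`, so Markov's inequality, with `cosh u ≥ exp u / 2`, gives the bound `2 exp(-l) =
  -- δ`.
  set c := r / (N * L) with hc
  have hcpos : 0 < c := by positivity
  have hYind : iIndepFun (fun i ω => c • X i ω) P :=
    hind.comp (fun _ x => c • x) fun _ => measurable_const_smul c
  have hbound := integral_cosh_norm_sum_le (P := P) (X := fun i ω => c • X i ω) (L := c * L)
    (fun i => (hmeas i).const_smul c) hYind (by positivity)
    (fun i ω => by
      rw [norm_smul, Real.norm_of_nonneg hcpos.le]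
      exact mul_le_mul_of_nonneg_left (hb i ω) hcpos.le)
    (fun i => by rw [integral_smul, hmean i, smul_zero]) Finset.univ
  have hnorm : ∀ ω, ‖∑ i, c • X i ω‖ = c * ‖∑ i, X i ω‖ := fun ω => by
    rw [← Finset.smul_sum, norm_smul, Real.norm_of_nonneg hcpos.le]
  simp only [hnorm, Finset.card_univ] at hbound
  have hSm : Measurable fun ω => ∑ i, X i ω := by fun_prop
  have hint : Integrable (fun ω => Real.cosh (c * ‖∑ i, X i ω‖)) P := by
    refine integrable_comp_of_norm_le (C := Real.cosh (c * (N * L)))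
      (Real.measurable_cosh.comp (hSm.norm.const_mul c)).aestronglyMeasurable fun ω => ?_
    rw [Real.norm_of_nonneg (Real.cosh_pos _).le]
    refine Real.cosh_le_cosh.2 ?_
    rw [abs_of_nonneg (by positivity), abs_of_nonneg (by positivity)]
    gcongr
    simpa [hN] using norm_sum_le_of_le Finset.univ fun i _ => hb i ω
  have hmarkov := mul_meas_ge_le_integral_of_nonneg
    (Filter.Eventually.of_forall fun ω => (Real.cosh_pos (c * ‖∑ i, X i ω‖)).le) hint
    (Real.exp (2 * l) / 2)
  have hcr : c * (L * r) = 2 * l := by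
    rw [hc]; field_simp; rw [hr2]; ring
  have hsub : {ω | L * r < ‖∑ i, X i ω‖} ⊆
      {ω | Real.exp (2 * l) / 2 ≤ Real.cosh (c * ‖∑ i, X i ω‖)} := fun ω hω => by
    have h1 : 2 * l ≤ c * ‖∑ i, X i ω‖ := by
      rw [← hcr]; exact mul_le_mul_of_nonneg_left (le_of_lt hω) hcpos.le
    have h2 := Real.exp_le_exp.2 h1
    have h3 := Real.exp_pos (-(c * ‖∑ i, X i ω‖))
    simp only [Set.mem_ofPred_eq, Real.cosh_eq]
    linarith
  have hmono := measureReal_mono (μ := P) hsub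
  have hcosh : Real.cosh (c * L) ^ Fintype.card ι ≤ Real.exp l := by
    calc Real.cosh (c * L) ^ Fintype.card ι ≤ Real.exp ((c * L) ^ 2 / 2) ^ Fintype.card ι := by
          have := (Real.cosh_pos (c * L)).le
          gcongr
          exact Real.cosh_le_exp_half_sq _
      _ = Real.exp l := by
          rw [← Real.exp_nat_mul, ← hN]
          congr 1
          rw [hc]; field_simp; rw [hr2]; ring
  have hexp : Real.exp l = 2 / δ := Real.exp_log (by positivity)
  have hexp2 : Real.exp (2 * l) = (2 / δ) ^ 2 := by
    rw [two_mul, Real.exp_add, hexp, sq]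
  have hfin : Real.exp (2 * l) / 2 * P.real {ω | L * r < ‖∑ i, X i ω‖} ≤ 2 / δ := by
    refine le_trans ?_ ((hmarkov.trans hbound).trans (hcosh.trans hexp.le))
    gcongr
  rw [hexp2] at hfin
  have : (2 / δ) ^ 2 / 2 = 2 / δ * (1 / δ) := by ring
  rw [this, mul_assoc] at hfin
  have h4 := (mul_le_iff_le_one_right (by positivity)).1 hfin
  rwa [one_div, inv_mul_le_iff₀ hδ, mul_one] at h4

end Pinelis

namespace EDMD

/-! ### Matrix perturbation and passage to operators -/

section Matrices

open scoped Matrix Matrix.Norms.L2Operator ComplexOrder MatrixOrder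

variable {𝕜 : Type*} [RCLike 𝕜] {n : ℕ}

/-- A vector indexed by pairs, read as a matrix. -/
def matOf (e : EuclideanSpace ℝ (Fin n × Fin n)) : Matrix (Fin n) (Fin n) ℝ :=
  Matrix.of fun i j => e (i, j)

theorem matOf_sub (e e' : EuclideanSpace ℝ (Fin n × Fin n)) :
    matOf (e - e') = matOf e - matOf e' := rfl

/-- A real matrix with its entries regarded as scalars in `𝕜`. -/
noncomputable abbrev scalarMap (𝕜 : Type*) [RCLike 𝕜] (M : Matrix (Fin n) (Fin n) ℝ) :
    Matrix (Fin n) (Fin n) 𝕜 :=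
  (algebraMap ℝ 𝕜).mapMatrix M

/-- The operator norm of a matrix is at most its Frobenius norm. -/
theorem norm_scalarMap_matOf_le (e : EuclideanSpace ℝ (Fin n × Fin n)) :
    ‖scalarMap 𝕜 (matOf e)‖ ≤ ‖e‖ := by
  rw [Matrix.cstar_norm_def]
  refine ContinuousLinearMap.opNorm_le_bound _ (norm_nonneg _) fun x => ?_
  refine (sq_le_sq₀ (norm_nonneg _) (by positivity)).1 ?_
  rw [mul_pow, EuclideanSpace.norm_sq_eq, EuclideanSpace.norm_sq_eq e, Fintype.sum_prod_type,
    Finset.sum_mul]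
  refine Finset.sum_le_sum fun i _ => ?_
  rw [Matrix.ofLp_toEuclideanCLM]
  calc ‖(scalarMap 𝕜 (matOf e)).mulVec x.ofLp i‖ ^ 2
      ≤ (∑ j, ‖e (i, j)‖ * ‖x j‖) ^ 2 := by
        gcongr
        refine (norm_sum_le Finset.univ
          fun j => scalarMap 𝕜 (matOf e) i j * x.ofLp j).trans_eq ?_
        simp [matOf]
    _ ≤ (∑ j, ‖e (i, j)‖ ^ 2) * ∑ j, ‖x j‖ ^ 2 := Finset.sum_mul_sq_le_sq_mul_sq _ _ _
    _ = _ := by rw [EuclideanSpace.norm_sq_eq x]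

theorem isUnit_of_lambdaMin_pos {G : Matrix (Fin n) (Fin n) ℝ} (h : 0 < lambdaMin G) :
    IsUnit G := by
  by_contra hcon
  have h0 : (0 : ℝ) ∈ spectrum ℝ G := by rwa [spectrum.zero_mem_iff]
  exact absurd h (not_lt.2 (csInf_le (Matrix.finite_real_spectrum (A := G)).bddBelow h0))

theorem posSemidef_sub_of_le_lambdaMin {G : Matrix (Fin n) (Fin n) ℝ} (hG : G.IsHermitian)
    {γ : ℝ} (h : γ ≤ lambdaMin G) : (G - algebraMap ℝ _ γ).PosSemidef := by
  rw [Matrix.posSemidef_iff_isHermitian_and_spectrum_nonneg]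
  refine ⟨hG.sub ?_, ?_⟩
  · rw [Algebra.algebraMap_eq_smul_one]
    exact Matrix.isHermitian_one.smul (IsSelfAdjoint.all γ)
  · rw [← spectrum.sub_singleton_eq]
    rintro _ ⟨a, ha, b, rfl, rfl⟩
    have := csInf_le (Matrix.finite_real_spectrum (A := G)).bddBelow ha
    exact sub_nonneg.2 (h.trans this)

/-- A factorisation `G = CᵀC` over the reals remains one of the form `C*C` over `𝕜`. -/
theorem posSemidef_scalarMap {G : Matrix (Fin n) (Fin n) ℝ} (hG : G.PosSemidef) :
    (scalarMap 𝕜 G).PosSemidef := by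
  obtain ⟨C, rfl⟩ := CStarAlgebra.nonneg_iff_eq_star_mul_self.1 hG.nonneg
  rw [scalarMap, map_mul]
  convert! Matrix.posSemidef_conjTranspose_mul_self (scalarMap 𝕜 C) using 2
  ext i j
  simp [Matrix.star_apply]

theorem mul_norm_sq_le_of_le_lambdaMin {G : Matrix (Fin n) (Fin n) ℝ} (hG : G.IsHermitian)
    {γ : ℝ} (h : γ ≤ lambdaMin G) (c : EuclideanSpace 𝕜 (Fin n)) :
    γ * ‖c‖ ^ 2 ≤
      RCLike.re (inner 𝕜 c (Matrix.toEuclideanCLM (n := Fin n) (𝕜 := 𝕜) (scalarMap 𝕜 G) c)) := by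
  have hps := posSemidef_scalarMap (𝕜 := 𝕜) (posSemidef_sub_of_le_lambdaMin hG h)
  have h1 := hps.re_dotProduct_nonneg c.ofLp
  have h2 : scalarMap 𝕜 (G - algebraMap ℝ _ γ) = scalarMap 𝕜 G - (γ : 𝕜) • 1 := by
    rw [scalarMap, map_sub, Algebra.algebraMap_eq_smul_one]
    congr 1
    ext i j
    by_cases hij : i = j <;> simp [hij]
  rw [h2, Matrix.sub_mulVec, dotProduct_sub, map_sub, Matrix.smul_mulVec, Matrix.one_mulVec,
    dotProduct_smul, smul_eq_mul, RCLike.re_ofReal_mul] at h1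
  have h3 : RCLike.re (star c.ofLp ⬝ᵥ c.ofLp) = ‖c‖ ^ 2 := by
    rw [← inner_self_eq_norm_sq (𝕜 := 𝕜), EuclideanSpace.inner_eq_star_dotProduct, dotProduct_comm]
  rw [h3] at h1
  rw [EuclideanSpace.inner_eq_star_dotProduct, Matrix.ofLp_toEuclideanCLM, dotProduct_comm]
  linarith

/-- For `x = G⁻¹y`, coercivity and Cauchy–Schwarz give `γ‖x‖² ≤ Re ⟨x, Gx⟩ ≤ ‖x‖‖y‖`. -/
theorem norm_scalarMap_inv_le {G : Matrix (Fin n) (Fin n) ℝ} (hG : G.IsHermitian)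
    {γ : ℝ} (hγ : 0 < γ) (h : γ ≤ lambdaMin G) : ‖scalarMap 𝕜 G⁻¹‖ ≤ 1 / γ := by
  have hu := isUnit_of_lambdaMin_pos (hγ.trans_le h)
  rw [Matrix.cstar_norm_def]
  refine ContinuousLinearMap.opNorm_le_bound _ (by positivity) fun y => ?_
  set x := Matrix.toEuclideanCLM (n := Fin n) (𝕜 := 𝕜) (scalarMap 𝕜 G⁻¹) y with hx
  have hGx : Matrix.toEuclideanCLM (n := Fin n) (𝕜 := 𝕜) (scalarMap 𝕜 G) x = y := by
    rw [hx, ← mul_apply_eq_comp, ← map_mul, scalarMap, scalarMap, ← map_mul,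
      Matrix.mul_nonsing_inv _ ((Matrix.isUnit_iff_isUnit_det _).1 hu), map_one, map_one]
    rfl
  have h1 := mul_norm_sq_le_of_le_lambdaMin (𝕜 := 𝕜) hG h x
  rw [hGx] at h1
  have h2 := h1.trans ((RCLike.re_le_norm _).trans (norm_inner_le_norm x y))
  rw [one_div, ← div_eq_inv_mul, le_div_iff₀ hγ]
  rcases (norm_nonneg x).eq_or_lt with h0 | hpos
  · rw [← h0, zero_mul]; exact norm_nonneg y
  · refine le_of_mul_le_mul_left ?_ hpos
    linarith [h2]

theorem norm_mul_inv_sub_mul_inv_le {A A' G G' : Matrix (Fin n) (Fin n) ℝ}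
    (hG : G.IsHermitian) (hG' : G'.IsHermitian) {γ γ' b ε : ℝ} (hγ : 0 < γ) (hγ' : 0 < γ')
    (h : γ ≤ lambdaMin G) (h' : γ' ≤ lambdaMin G') (hA' : ‖scalarMap 𝕜 A'‖ ≤ b)
    (hAA : ‖scalarMap 𝕜 (A' - A)‖ ≤ ε) (hGG : ‖scalarMap 𝕜 (G' - G)‖ ≤ ε) :
    ‖scalarMap 𝕜 (A' * G'⁻¹ - A * G⁻¹)‖ ≤ ε / γ * (b / γ' + 1) := by
  have hu := (Matrix.isUnit_iff_isUnit_det _).1 (isUnit_of_lambdaMin_pos (hγ.trans_le h))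
  have hu' := (Matrix.isUnit_iff_isUnit_det _).1 (isUnit_of_lambdaMin_pos (hγ'.trans_le h'))
  have hb : 0 ≤ b := (norm_nonneg _).trans hA'
  have hε : 0 ≤ ε := (norm_nonneg _).trans hAA
  have hdecomp : A' * G'⁻¹ - A * G⁻¹ = (A' - A) * G⁻¹ - A' * G'⁻¹ * (G' - G) * G⁻¹ := by
    rw [mul_sub, sub_mul, sub_mul, mul_assoc A' G'⁻¹ G', Matrix.nonsing_inv_mul _ hu', mul_one,
      mul_assoc (A' * G'⁻¹) G, Matrix.mul_nonsing_inv _ hu, mul_one]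
    abel
  have hi := norm_scalarMap_inv_le (𝕜 := 𝕜) hG hγ h
  have hi' := norm_scalarMap_inv_le (𝕜 := 𝕜) hG' hγ' h'
  rw [hdecomp]
  calc ‖scalarMap 𝕜 ((A' - A) * G⁻¹ - A' * G'⁻¹ * (G' - G) * G⁻¹)‖
      ≤ ‖scalarMap 𝕜 (A' - A)‖ * ‖scalarMap 𝕜 G⁻¹‖ +
        ‖scalarMap 𝕜 A'‖ * ‖scalarMap 𝕜 G'⁻¹‖ * ‖scalarMap 𝕜 (G' - G)‖ * ‖scalarMap 𝕜 G⁻¹‖ := by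
        simp only [scalarMap, map_sub, map_mul]
        refine (norm_sub_le _ _).trans (add_le_add (norm_mul_le _ _) ?_)
        refine (norm_mul_le _ _).trans ?_
        gcongr
        refine (norm_mul_le _ _).trans ?_
        gcongr
        exact norm_mul_le _ _
    _ ≤ ε * (1 / γ) + b * (1 / γ') * ε * (1 / γ) := by gcongr
    _ = ε / γ * (b / γ' + 1) := by ring

variable {E : Type*} [NormedAddCommGroup E] [InnerProductSpace 𝕜 E]

theorem norm_sq_sum_smul_eq (φ : Fin n → E) {G : Matrix (Fin n) (Fin n) ℝ}
    (hG : ∀ i j, inner 𝕜 (φ i) (φ j) = ((G i j : ℝ) : 𝕜)) (c : EuclideanSpace 𝕜 (Fin n)) :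
    ‖∑ i, c i • φ i‖ ^ 2 =
      RCLike.re (inner 𝕜 c (Matrix.toEuclideanCLM (n := Fin n) (𝕜 := 𝕜) (scalarMap 𝕜 G) c)) := by
  rw [← inner_self_eq_norm_sq (𝕜 := 𝕜), PiLp.inner_apply, sum_inner]
  congr 1
  refine Finset.sum_congr rfl fun i _ => ?_
  rw [inner_sum, Matrix.ofLp_toEuclideanCLM]
  simp only [inner_smul_left, inner_smul_right, hG, RCLike.inner_apply, Matrix.mulVec, dotProduct,
    Finset.sum_mul]
  refine Finset.sum_congr rfl fun j _ => ?_
  simp only [RingHom.mapMatrix_apply, Matrix.map_apply, RCLike.algebraMap_eq_ofReal]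
  ring

/-- The Gram form makes the coordinate map `c ↦ ∑ cᵢφᵢ` have norm at most `b` and its inverse norm
at most `1/√γ`; the projection is a contraction. -/
theorem operatorDeviation_le (φ : Fin n → E) (hφ : LinearIndependent 𝕜 φ)
    {G : Matrix (Fin n) (Fin n) ℝ} (hGs : G.IsHermitian)
    (hG : ∀ i j, inner 𝕜 (φ i) (φ j) = ((G i j : ℝ) : 𝕜)) {γ b : ℝ} (hγ : 0 < γ) (hb : 0 ≤ b)
    (hlow : γ ≤ lambdaMin G) (hup : ‖scalarMap 𝕜 G‖ ≤ b ^ 2) (M N : Matrix (Fin n) (Fin n) ℝ) :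
    operatorDeviation (𝕜 := 𝕜) φ M N ≤ b / √γ * ‖scalarMap 𝕜 (M - N)‖ := by
  have hupper : ∀ c : EuclideanSpace 𝕜 (Fin n), ‖∑ i, c i • φ i‖ ≤ b * ‖c‖ := fun c => by
    refine (sq_le_sq₀ (norm_nonneg _) (by positivity)).1 ?_
    rw [norm_sq_sum_smul_eq φ hG]
    refine (RCLike.re_le_norm _).trans ((norm_inner_le_norm _ _).trans ?_)
    have h1 := (Matrix.toEuclideanCLM (n := Fin n) (𝕜 := 𝕜) (scalarMap 𝕜 G)).le_opNorm c
    rw [← Matrix.cstar_norm_def] at h1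
    have h2 := h1.trans (mul_le_mul_of_nonneg_right hup (norm_nonneg c))
    nlinarith [mul_le_mul_of_nonneg_left h2 (norm_nonneg c)]
  have hlower : ∀ c : EuclideanSpace 𝕜 (Fin n), √γ * ‖c‖ ≤ ‖∑ i, c i • φ i‖ := fun c => by
    refine (sq_le_sq₀ (by positivity) (norm_nonneg _)).1 ?_
    rw [norm_sq_sum_smul_eq φ hG, mul_pow, Real.sq_sqrt hγ.le]
    exact mul_norm_sq_le_of_le_lambdaMin hGs hlow c
  refine ContinuousLinearMap.opNorm_le_bound _ (by positivity) fun x => ?_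
  set p := (latentSpace 𝕜 φ).orthogonalProjectionOnto x with hp
  have hpx : ‖p‖ ≤ ‖x‖ := (latentSpace 𝕜 φ).norm_orthogonalProjectionOnto_apply_le x
  set c : EuclideanSpace 𝕜 (Fin n) := WithLp.toLp 2 ((Module.Basis.span hφ).repr p) with hc
  have hpc : p = ∑ i, c i • gen 𝕜 φ i := by
    conv_lhs => rw [← (Module.Basis.span hφ).sum_repr p]
    refine Finset.sum_congr rfl fun i _ => ?_
    congr 1
    ext; simp [gen, Module.Basis.span_apply]
  -- Sending `φᵢ` to `∑ⱼ Mᵢⱼ φⱼ` acts on coefficients by the transpose. As the entries are real,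
  -- this is the conjugate transpose, which has the same operator norm.
  set d : EuclideanSpace 𝕜 (Fin n) :=
    Matrix.toEuclideanCLM (n := Fin n) (𝕜 := 𝕜) (scalarMap 𝕜 (M - N)).conjTranspose c with hd
  have hTd : (((matrixOperator (𝕜 := 𝕜) φ M - matrixOperator (𝕜 := 𝕜) φ N) p : latentSpace 𝕜 φ) : E)
      = ∑ j, d j • φ j := by
    rw [hpc]
    simp only [map_sum, map_smul, sub_apply, matrixOperator_gen φ hφ,
      ← Finset.sum_sub_distrib, ← sub_smul, Finset.smul_sum, smul_smul]
    rw [Finset.sum_comm]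
    simp only [AddSubmonoidClass.coe_finsetSum, Submodule.coe_smul, gen, ← Finset.sum_smul]
    refine Finset.sum_congr rfl fun j _ => ?_
    congr 1
    rw [hd, Matrix.ofLp_toEuclideanCLM, Matrix.mulVec, dotProduct]
    refine Finset.sum_congr rfl fun i _ => ?_
    simp [mul_comm]
  have hdn : ‖d‖ ≤ ‖scalarMap 𝕜 (M - N)‖ * ‖c‖ := by
    rw [← Matrix.l2_opNorm_conjTranspose, Matrix.cstar_norm_def]
    exact ContinuousLinearMap.le_opNorm _ c
  have hcp : √γ * ‖c‖ ≤ ‖x‖ := by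
    refine (hlower c).trans (le_trans (le_of_eq ?_) hpx)
    rw [hpc, Submodule.coe_norm]
    simp [gen]
  have hsγ : 0 < √γ := Real.sqrt_pos.2 hγ
  calc _ = ‖∑ j, d j • φ j‖ := by rw [← hTd]; rfl
    _ ≤ b * ‖d‖ := hupper d
    _ ≤ b * (‖scalarMap 𝕜 (M - N)‖ * ‖c‖) := by gcongr
    _ ≤ b * (‖scalarMap 𝕜 (M - N)‖ * (‖x‖ / √γ)) := by
      gcongr
      rw [le_div_iff₀ hsγ, mul_comm]
      exact hcp
    _ = b / √γ * ‖scalarMap 𝕜 (M - N)‖ * ‖x‖ := by ring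

end Matrices

end EDMD

namespace EDMD

/-! ### Concentration of the empirical matrices and the sampling error -/

section Sampling

open scoped Matrix.Norms.L2Operator

variable {S : Type*} {n m : ℕ}

/-- The outer product `u vᵀ`, as a vector of the Euclidean space of pairs of indices. -/
noncomputable def outerVec (u v : EuclideanSpace ℝ (Fin n)) :
    EuclideanSpace ℝ (Fin n × Fin n) :=
  WithLp.toLp 2 fun p => u p.1 * v p.2

theorem norm_outerVec (u v : EuclideanSpace ℝ (Fin n)) : ‖outerVec u v‖ = ‖u‖ * ‖v‖ := by
  refine (sq_eq_sq₀ (norm_nonneg _) (by positivity)).1 ?_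
  rw [mul_pow, EuclideanSpace.norm_sq_eq, EuclideanSpace.norm_sq_eq u, EuclideanSpace.norm_sq_eq v,
    Fintype.sum_prod_type, Finset.sum_mul_sum]
  simp [outerVec, mul_pow]

theorem norm_outerVec_le {u v : EuclideanSpace ℝ (Fin n)} {B : ℝ} (hu : ‖u‖ ≤ B) (hv : ‖v‖ ≤ B) :
    ‖outerVec u v‖ ≤ B ^ 2 := by
  rw [norm_outerVec, sq]
  exact mul_le_mul hu hv (norm_nonneg _) ((norm_nonneg _).trans hu)

/-- The vector form of `empCorr`. -/
noncomputable def empVec (f : S → S) (Φ : S → EuclideanSpace ℝ (Fin n)) (x : Fin m → S) :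
    EuclideanSpace ℝ (Fin n × Fin n) :=
  (1 / (m : ℝ)) • ∑ k, outerVec (Φ (f (x k))) (Φ (x k))

theorem matOf_empVec (f : S → S) (Φ : S → EuclideanSpace ℝ (Fin n)) (x : Fin m → S) :
    matOf (empVec f Φ x) = empCorr f Φ x := by
  ext i j
  simp [matOf, empVec, empCorr, outerVec, Matrix.vecMulVec_apply, Matrix.sum_apply]

theorem norm_empVec_le (f : S → S) {Φ : S → EuclideanSpace ℝ (Fin n)} {B : ℝ}
    (hB : ∀ x, ‖Φ x‖ ≤ B) (x : Fin m → S) : ‖empVec f Φ x‖ ≤ B ^ 2 := by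
  rw [empVec, norm_smul, Real.norm_of_nonneg (by positivity)]
  have h := norm_sum_le_of_le Finset.univ
    fun k _ => norm_outerVec_le (hB (f (x k))) (hB (x k))
  rw [Finset.sum_const, Finset.card_univ, Fintype.card_fin, nsmul_eq_mul] at h
  rcases Nat.eq_zero_or_pos m with rfl | hm
  · simp; positivity
  · have : (0 : ℝ) < m := by exact_mod_cast hm
    rw [one_div, inv_mul_le_iff₀ this]
    exact h

theorem isHermitian_empGram (Φ : S → EuclideanSpace ℝ (Fin n)) (x : Fin m → S) :
    (empGram Φ x).IsHermitian := by
  ext i j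
  simp [empGram, Matrix.vecMulVec_apply, Matrix.sum_apply, mul_comm]

variable [MeasurableSpace S] (μ : Measure S)

theorem isHermitian_popGram (Φ : S → EuclideanSpace ℝ (Fin n)) : (popGram μ Φ).IsHermitian := by
  ext i j
  simp [popGram, mul_comm]

/-- The vector form of `popCorr`. -/
noncomputable def popVec (f : S → S) (Φ : S → EuclideanSpace ℝ (Fin n)) :
    EuclideanSpace ℝ (Fin n × Fin n) :=
  ∫ s, outerVec (Φ (f s)) (Φ s) ∂μ

variable [IsProbabilityMeasure μ] {f : S → S} {Φ : S → EuclideanSpace ℝ (Fin n)} {B : ℝ}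

theorem measurable_outerVec_comp (hf : Measurable f) (hΦ : Measurable Φ) :
    Measurable fun s => outerVec (Φ (f s)) (Φ s) := by
  unfold outerVec
  fun_prop

theorem integrable_outerVec (hf : Measurable f) (hΦ : Measurable Φ) (hB : ∀ x, ‖Φ x‖ ≤ B) :
    Integrable (fun s => outerVec (Φ (f s)) (Φ s)) μ :=
  integrable_comp_of_norm_le (measurable_outerVec_comp hf hΦ).aestronglyMeasurable
    fun s => norm_outerVec_le (hB (f s)) (hB s)

theorem matOf_popVec (hf : Measurable f) (hΦ : Measurable Φ) (hB : ∀ x, ‖Φ x‖ ≤ B) :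
    matOf (popVec μ f Φ) = popCorr μ f Φ := by
  ext i j
  exact ((EuclideanSpace.proj (𝕜 := ℝ) (i, j)).integral_comp_comm
    (integrable_outerVec μ hf hΦ hB)).symm

theorem norm_popVec_le (hB : ∀ x, ‖Φ x‖ ≤ B) : ‖popVec μ f Φ‖ ≤ B ^ 2 := by
  simpa [popVec] using norm_integral_le_of_norm_le_const (μ := μ)
    (Filter.Eventually.of_forall fun s => norm_outerVec_le (hB (f s)) (hB s))

/-- Pinelis' inequality for the centred outer products, whose norms are at most `B² + B² = 2B²`. -/
theorem measureReal_norm_empVec_sub_popVec_gt_le {Ω : Type*} [MeasurableSpace Ω] (P : Measure Ω)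
    [IsProbabilityMeasure P] (hf : Measurable f) (hm : 0 < m) (hΦ : Measurable Φ)
    {s : Fin m → Ω → S} (hs : ∀ i, Measurable (s i)) (hindep : iIndepFun s P)
    (hlaw : ∀ i, P.map (s i) = μ) (hBpos : 0 < B) (hB : ∀ x, ‖Φ x‖ ≤ B)
    {δ : ℝ} (hδ : 0 < δ) (hδ2 : δ < 2) :
    P.real {ω | 2 * √2 * B ^ 2 * √(Real.log (2 / δ) / m) <
      ‖empVec f Φ (fun i => s i ω) - popVec μ f Φ‖} ≤ δ := by
  have : Nonempty (Fin m) := ⟨⟨0, hm⟩⟩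
  have hm' : (0 : ℝ) < m := by exact_mod_cast hm
  have hUm := measurable_outerVec_comp hf hΦ
  have hcm : Measurable fun x => outerVec (Φ (f x)) (Φ x) - popVec μ f Φ := hUm.sub_const _
  have hpin := measureReal_norm_sum_gt_le (P := P) (L := 2 * B ^ 2)
    (X := fun i ω => outerVec (Φ (f (s i ω))) (Φ (s i ω)) - popVec μ f Φ)
    (fun i => hcm.comp (hs i)) (hindep.comp (fun _ x => outerVec (Φ (f x)) (Φ x) - popVec μ f Φ)
      fun _ => hcm) (by positivity)
    (fun i ω => by
      have h1 := norm_outerVec_le (hB (f (s i ω))) (hB (s i ω))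
      have h2 := norm_popVec_le (f := f) μ hB
      exact (norm_sub_le _ _).trans (by linarith))
    (fun i => by
      have h1 := integral_map (μ := P) (hs i).aemeasurable
        (f := fun x => outerVec (Φ (f x)) (Φ x) - popVec μ f Φ) hcm.aestronglyMeasurable
      rw [← h1, hlaw i, integral_sub (integrable_outerVec μ hf hΦ hB) (integrable_const _)]
      simp [popVec]) hδ hδ2
  refine le_trans (measureReal_mono fun ω hω => ?_) hpin
  simp only [Set.mem_ofPred_eq, Fintype.card_fin, Finset.sum_sub_distrib, Finset.sum_const,
    Finset.card_univ] at hω ⊢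
  have hsum : ∑ i, outerVec (Φ (f (s i ω))) (Φ (s i ω)) - m • popVec μ f Φ =
      (m : ℝ) • (empVec f Φ (fun i => s i ω) - popVec μ f Φ) := by
    rw [empVec, smul_sub, smul_smul, mul_one_div_cancel hm'.ne', one_smul, Nat.cast_smul_eq_nsmul]
  have hsqrt : √(2 * m * Real.log (2 / δ)) = m * (√2 * √(Real.log (2 / δ) / m)) := by
    rw [← Real.sqrt_mul zero_le_two, ← Real.sqrt_sq hm'.le, ← Real.sqrt_mul (sq_nonneg _),
      Real.sqrt_sq hm'.le]
    congr 1
    field_simp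
  rw [hsum, norm_smul, Real.norm_of_nonneg hm'.le, hsqrt]
  calc 2 * B ^ 2 * (m * (√2 * √(Real.log (2 / δ) / m)))
      = m * (2 * √2 * B ^ 2 * √(Real.log (2 / δ) / m)) := by ring
    _ < _ := by gcongr

theorem samplingError_le (𝕜 : Type*) [RCLike 𝕜] (hf : Measurable f) (hΦ : Measurable Φ)
    (hBpos : 0 < B) (hB : ∀ x, ‖Φ x‖ ≤ B) {γ : ℝ} (hγ : 0 < γ)
    (hgram : γ ≤ lambdaMin (popGram μ Φ)) {x : Fin m → S}
    (hemp : γ / 2 ≤ lambdaMin (empGram Φ x)) {ε : ℝ}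
    (hA : ‖empVec f Φ x - popVec μ f Φ‖ ≤ ε) (hG : ‖empVec id Φ x - popVec μ id Φ‖ ≤ ε) :
    samplingError 𝕜 μ f hΦ hB x ≤ B / √γ * (ε / γ * (2 * B ^ 2 / γ + 1)) := by
  -- The Gram matrices are the correlation matrices for `f = id`, so the same estimates serve both.
  have hpop : matOf (popVec μ id Φ) = popGram μ Φ := matOf_popVec μ measurable_id hΦ hB
  have hempG : matOf (empVec id Φ x) = empGram Φ x := matOf_empVec id Φ x
  have hdev := operatorDeviation_le (𝕜 := 𝕜) (feature 𝕜 μ hΦ hB)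
    (linearIndependent_feature 𝕜 μ hΦ hB (hγ.trans_le hgram)) (isHermitian_popGram μ Φ)
    (inner_feature 𝕜 μ hΦ hB) hγ hBpos.le hgram
    (by
      rw [← hpop]
      exact (norm_scalarMap_matOf_le _).trans (norm_popVec_le μ hB))
    (empMatrix f Φ x) (popMatrix μ f Φ)
  have hmat := norm_mul_inv_sub_mul_inv_le (𝕜 := 𝕜) (A := popCorr μ f Φ) (A' := empCorr f Φ x)
    (isHermitian_popGram μ Φ) (isHermitian_empGram Φ x) hγ (half_pos hγ) hgram hemp (b := B ^ 2)
    (ε := ε)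
    (by
      rw [← matOf_empVec]
      exact (norm_scalarMap_matOf_le _).trans (norm_empVec_le f hB x))
    (by
      rw [← matOf_empVec, ← matOf_popVec μ hf hΦ hB, ← matOf_sub]
      exact (norm_scalarMap_matOf_le _).trans hA)
    (by
      rw [← hempG, ← hpop, ← matOf_sub]
      exact (norm_scalarMap_matOf_le _).trans hG)
  refine hdev.trans ?_
  have hrw : B ^ 2 / (γ / 2) = 2 * B ^ 2 / γ := by field_simp
  rw [hrw] at hmat
  gcongr
  exact hmat

end Sampling

end EDMD

/-! ### The probabilistic bound -/

theorem mainTheorem1 (𝕜 : Type*) [RCLike 𝕜] {S Ω : Type*} [MeasurableSpace S] [MeasurableSpace Ω]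
    (P : Measure Ω) [IsProbabilityMeasure P] (μ : Measure S) [IsProbabilityMeasure μ]
    (f : S → S) (hf : MeasurePreserving f μ μ)
    (n m : ℕ) (hm : 0 < m)
    (Φ : S → EuclideanSpace ℝ (Fin n)) (hΦ : Measurable Φ)
    (s : Fin m → Ω → S) (hs : ∀ i, Measurable (s i))
    (hindep : iIndepFun s P) (hlaw : ∀ i, P.map (s i) = μ)
    (B : ℝ) (hBpos : 0 < B) (hB : ∀ x, ‖Φ x‖ ≤ B)
    (γ : ℝ) (hγ : 0 < γ) (hgram : γ ≤ EDMD.lambdaMin (EDMD.popGram μ Φ))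
    (δm : ℝ)
    (hemp : 1 - δm ≤ P.real {ω | γ / 2 ≤ EDMD.lambdaMin (EDMD.empGram Φ fun i => s i ω)})
    (δ : ℝ) (hδ : 0 < δ) :
    1 - 2 * δ - δm ≤ P.real {ω |
      IsUnit (EDMD.empGram Φ fun i => s i ω) ∧
      EDMD.samplingError 𝕜 μ f hΦ hB (fun i => s i ω) ≤
        4 * B ^ 3 / (3 * √(γ ^ 3)) * (2 * B ^ 2 / γ + 1) * (Real.log (2 * n / δ) / m) +
        2 * √2 * B ^ 3 / √(γ ^ 3) * (2 * B ^ 2 / γ + 1) * √(Real.log (2 * n / δ) / m)} := by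
  rcases le_or_gt 1 δ with hδ1 | hδ1
  -- Here `δm ≥ 0`, so the claimed lower bound on the probability is negative.
  · have h1 := hemp.trans measureReal_le_one
    exact le_trans (by linarith) measureReal_nonneg
  have hn : 1 ≤ n := by
    rcases Nat.eq_zero_or_pos n with rfl | hn
    -- For `n = 0` the spectrum is empty and `sInf ∅ = 0`, contradicting `γ > 0`. The case must go
    -- because `ln(2/δ) ≤ ln(2n/δ)` needs `n ≥ 1`.
    · have : EDMD.lambdaMin (EDMD.popGram μ Φ) = 0 := by
        rw [EDMD.lambdaMin, spectrum.of_subsingleton, Real.sInf_empty]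
      linarith
    · exact hn
  have hn' : (1 : ℝ) ≤ n := by exact_mod_cast hn
  have hm' : (0 : ℝ) < m := by exact_mod_cast hm
  have hlog : Real.log (2 / δ) ≤ Real.log (2 * n / δ) := by
    refine Real.log_le_log (by positivity) ?_
    gcongr
    linarith
  have hlog0 : 0 < Real.log (2 / δ) := Real.log_pos ((one_lt_div hδ).2 (by linarith))
  set ε := 2 * √2 * B ^ 2 * √(Real.log (2 / δ) / m) with hε
  have hA := EDMD.measureReal_norm_empVec_sub_popVec_gt_le μ P hf.measurable hm hΦ hs hindep hlaw
    hBpos hB hδ (by linarith)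
  have hG := EDMD.measureReal_norm_empVec_sub_popVec_gt_le μ P measurable_id hm hΦ hs hindep hlaw
    hBpos hB hδ (by linarith)
  set good := {ω | IsUnit (EDMD.empGram Φ fun i => s i ω) ∧
      EDMD.samplingError 𝕜 μ f hΦ hB (fun i => s i ω) ≤
        4 * B ^ 3 / (3 * √(γ ^ 3)) * (2 * B ^ 2 / γ + 1) * (Real.log (2 * n / δ) / m) +
        2 * √2 * B ^ 3 / √(γ ^ 3) * (2 * B ^ 2 / γ + 1) * √(Real.log (2 * n / δ) / m)} with hgood
  -- The eigenvalue event is covered by the good event and two events of probability at most `δ`,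
  -- whence the loss `2δ + δm`.
  have hsub : {ω | γ / 2 ≤ EDMD.lambdaMin (EDMD.empGram Φ fun i => s i ω)} ⊆
      good ∪ ({ω | ε < ‖EDMD.empVec f Φ (fun i => s i ω) - EDMD.popVec μ f Φ‖} ∪
        {ω | ε < ‖EDMD.empVec id Φ (fun i => s i ω) - EDMD.popVec μ id Φ‖}) := by
    intro ω hω
    by_contra hcon
    simp only [Set.mem_union, Set.mem_ofPred_eq, not_or, not_lt] at hcon hω
    refine hcon.1 ⟨EDMD.isUnit_of_lambdaMin_pos ((half_pos hγ).trans_le hω), ?_⟩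
    refine (EDMD.samplingError_le μ 𝕜 hf.measurable hΦ hBpos hB hγ hgram hω
      hcon.2.1 hcon.2.2).trans ?_
    have hs3 : √(γ ^ 3) = γ * √γ := by
      rw [pow_succ, Real.sqrt_mul (sq_nonneg γ), Real.sqrt_sq hγ.le]
    have hsγ : 0 < √γ := Real.sqrt_pos.2 hγ
    -- The deterministic bound is exactly the variance term, with `ln(2/δ)` in place of `ln(2n/δ)`.
    have hvar : B / √γ * (ε / γ * (2 * B ^ 2 / γ + 1)) =
        2 * √2 * B ^ 3 / √(γ ^ 3) * (2 * B ^ 2 / γ + 1) * √(Real.log (2 / δ) / m) := by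
      rw [hε, hs3]
      field_simp
    rw [hvar]
    have hbias : 0 ≤ 4 * B ^ 3 / (3 * √(γ ^ 3)) * (2 * B ^ 2 / γ + 1) *
        (Real.log (2 * n / δ) / m) := by
      have := hlog0.le.trans hlog
      positivity
    refine le_add_of_nonneg_of_le hbias ?_
    gcongr
  have h1 := (measureReal_mono (μ := P) hsub).trans (measureReal_union_le _ _)
  have h2 := measureReal_union_le (μ := P)
    {ω | ε < ‖EDMD.empVec f Φ (fun i => s i ω) - EDMD.popVec μ f Φ‖}
    {ω | ε < ‖EDMD.empVec id Φ (fun i => s i ω) - EDMD.popVec μ id Φ‖}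
  linarith
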